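/- Let $\mathcal{A}$ be a finite set of action symbols, let $\tau\notin\mathcal{A}$ denote the unobservable action, and put $\mathcal{A}_\tau=\mathcal{A}\cup\{\tau\}$. A transition system is a quadruple $T=(S,\to,\uparrow,\downarrow)$ with a set of states $S$, a relation ${\to}\subseteq S\times\mathcal{A}_\tau\times S$, an initial state ${\uparrow}\in S$ and a set of final states ${\downarrow}\subseteq S$. Put $\mathit{out}(s)=\{(a,t)\mid s\xrightarrow{a}t\}$ and let $\mathit{fin}$ be the characteristic function of $\downarrow$. $T$ is boundedly branching if there is $B\in\mathbb{N}$ with $|\mathit{out}(s)|\le B$ for all $s\in S$. $T$ is computable if every $\mathit{out}(s)$ is finite and, for some injective codings of $\mathcal{A}_\tau$ and $S$ into $\mathbb{N}$, the partial functions $\mathbb{N}\rightharpoonup\mathbb{N}$ that map the code of a state $s$ to the code of $\mathit{out}(s)$ and to $\mathit{fin}(s)$, respectively, and that are undefined on numbers that are not codes of states, are partial recursive (pairs and finite sets of natural numbers being coded in the standard way). A reactive Turing machine (RTM) over a finite set $\mathcal{D}$ of data symbols, with blank $\Box\notin\mathcal{D}$ and $\mathcal{D}_\Box=\mathcal{D}\cup\{\Box\}$,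 consists of a finite set of states $Q$, an initial state, a set of final states, and a transition relation contained in $Q\times\mathcal{D}_\Box\times\mathcal{A}_\tau\times\mathcal{D}_\Box\times\{L,R\}\times Q$. Its transition system has as states the configurations (a state together with a two-way infinite tape with all but finitely many cells blank and a head position); an RTM-transition $(q,d,a,e,M,q')$ induces an $a$-labelled transition from each configuration with state $q$ and $d$ under the head to the configuration with state $q'$ in which $d$ has been replaced by $e$ and the head has moved one cell in direction $M$; the initial configuration is the initial state with the blank tape, and a configuration is final iff its state is. Write $\twoheadrightarrow$ and $\to^+$ for the reflexive-transitive and the transitive closure of $\xrightarrow{\tau}$, and $s\xrightarrow{(a)}t$ if $s\xrightarrow{a}t$, or $a=\tau$ and $s=t$. Transition systems $T_1,T_2$ are divergence-preserving branching bisimilar if there is a relation $R\subseteq S_1\times S_2$ that relates their initial states and is such that $s_1\mathrel{R}s_2$ implies the following conditions and their symmetric counterparts, with the roles of $T_1$ and $T_2$ exchanged: (i) if $s_1\xrightarrow{a}s_1'$, then there are $s_2'',s_2'$ with $s_2\twoheadrightarrow s_2''\xrightarrow{(a)}s_2'$, $s_1\mathrel{R}s_2''$ and $s_1'\mathrel{R}s_2'$;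 (ii) if $s_1$ is final, then there is a final $s_2'$ with $s_2\twoheadrightarrow s_2'$ and $s_1\mathrel{R}s_2'$; (iii) if $s_1=s_{1,0}\xrightarrow{\tau}s_{1,1}\xrightarrow{\tau}\cdots$ is an infinite sequence with $s_{1,i}\mathrel{R}s_2$ for all $i$, then there are $s_2'$ and $i$ with $s_2\to^+s_2'$ and $s_{1,i}\mathrel{R}s_2'$. Theorem. For every finite set $\mathcal{A}$ there is a finite set $\mathcal{D}$ of data symbols such that every boundedly branching computable transition system with labels in $\mathcal{A}_\tau$ is divergence-preserving branching bisimilar to the transition system associated with some RTM with action symbols $\mathcal{A}$ and data symbols $\mathcal{D}$. -/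

import Mathlib

universe u v w

namespace ReactiveTM

/-- The set `A ∪ {τ}` of actions: `some a` is the observable action `a`, and `none` is the
unobservable action `τ`. -/
abbrev Act (A : Type u) : Type u := Option A

/-- The unobservable action. -/
abbrev tau {A : Type u} : Act A := none

/-- The tape symbols `D ∪ {□}`: `some d` is the data symbol `d`, and `none` is the blank `□`. -/
abbrev TapeSymbol (D : Type u) : Type u := Option D

/-- A transition system with state set `S`, labelled by actions from `A ∪ {τ}`. -/
structure TransitionSystem (A : Type u) (S : Type v) where
  step : S → Act A → S → Prop
  init : S
  final : Set S

namespace TransitionSystem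

variable {A : Type u} {S : Type v} {S' : Type w}

/-- The set of outgoing transitions of a state. -/
def out (T : TransitionSystem A S) (s : S) : Set (Act A × S) :=
  {p | T.step s p.1 p.2}

open Classical in
/-- The characteristic function of the set of final states. -/
noncomputable def fin (T : TransitionSystem A S) (s : S) : ℕ :=
  if s ∈ T.final then 1 else 0

/-- The branching degree is bounded by `B`. -/
def BranchingDegreeBoundedBy (T : TransitionSystem A S) (B : ℕ) : Prop :=
  ∀ s, (T.out s).encard ≤ B

def BoundedlyBranching (T : TransitionSystem A S) : Prop :=
  ∃ B : ℕ, T.BranchingDegreeBoundedBy B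

def FinitelyBranching (T : TransitionSystem A S) : Prop :=
  ∀ s, (T.out s).Finite

/-- The canonical index `∑ 2 ^ n` (`n ∈ X`) of a finite set `X` of natural numbers. -/
def canonicalIndex (X : Finset ℕ) : ℕ := ∑ n ∈ X, 2 ^ n

/-- A finitely branching transition system is computable if, for some codings (injections into `ℕ`)
of actions and states, the functions `out` and `fin` are recursive. On natural numbers, these
are partial functions, defined precisely on the codes of states; a transition is coded as the pair
of the codes of its action and its target, a finite set of transitions by the canonical
index of the set of their codes. -/
def IsComputable (T : TransitionSystem A S) : Prop :=
  ∃ hfin : T.FinitelyBranching,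
  ∃ (codeAct : Act A → ℕ) (codeState : S → ℕ),
    Function.Injective codeAct ∧ Function.Injective codeState ∧
    ∃ outN finN : ℕ →. ℕ,
      Partrec outN ∧ Partrec finN ∧
      (∀ s, outN (codeState s) = Part.some (canonicalIndex
        ((hfin s).toFinset.image fun p => Nat.pair (codeAct p.1) (codeState p.2)))) ∧
      (∀ s, finN (codeState s) = Part.some (T.fin s)) ∧
      (∀ n, n ∉ Set.range codeState → outN n = Part.none ∧ finN n = Part.none)

/-- A single `τ`-transition. -/
def TauStep (T : TransitionSystem A S) (s t : S) : Prop := T.step s tau t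

/-- Zero or more `τ`-transitions. -/
def TauSteps (T : TransitionSystem A S) : S → S → Prop := Relation.ReflTransGen T.TauStep

/-- One or more `τ`-transitions. -/
def TauStepsPlus (T : TransitionSystem A S) : S → S → Prop := Relation.TransGen T.TauStep

/-- A transition labelled `a`, which may be omitted if `a = τ`. -/
def OptStep (T : TransitionSystem A S) (s : S) (a : Act A) (t : S) : Prop :=
  T.step s a t ∨ (a = tau ∧ s = t)

structure IsBranchingBisimulation (T₁ : TransitionSystem A S) (T₂ : TransitionSystem A S')
    (R : S → S' → Prop) : Prop where
  step_left : ∀ s₁ s₂, R s₁ s₂ → ∀ a s₁', T₁.step s₁ a s₁' →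
    ∃ s₂'' s₂', T₂.TauSteps s₂ s₂'' ∧ T₂.OptStep s₂'' a s₂' ∧ R s₁ s₂'' ∧ R s₁' s₂'
  step_right : ∀ s₁ s₂, R s₁ s₂ → ∀ a s₂', T₂.step s₂ a s₂' →
    ∃ s₁'' s₁', T₁.TauSteps s₁ s₁'' ∧ T₁.OptStep s₁'' a s₁' ∧ R s₁'' s₂ ∧ R s₁' s₂'
  final_left : ∀ s₁ s₂, R s₁ s₂ → s₁ ∈ T₁.final →
    ∃ s₂', T₂.TauSteps s₂ s₂' ∧ R s₁ s₂' ∧ s₂' ∈ T₂.final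
  final_right : ∀ s₁ s₂, R s₁ s₂ → s₂ ∈ T₂.final →
    ∃ s₁', T₁.TauSteps s₁ s₁' ∧ R s₁' s₂ ∧ s₁' ∈ T₁.final

structure IsDivergencePreservingBranchingBisimulation
    (T₁ : TransitionSystem A S) (T₂ : TransitionSystem A S') (R : S → S' → Prop) : Prop
    extends IsBranchingBisimulation T₁ T₂ R where
  divergence_left : ∀ s₁ s₂, R s₁ s₂ → ∀ σ : ℕ → S, σ 0 = s₁ →
    (∀ i, T₁.TauStep (σ i) (σ (i + 1))) → (∀ i, R (σ i) s₂) →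
    ∃ s₂', T₂.TauStepsPlus s₂ s₂' ∧ ∃ i, R (σ i) s₂'
  divergence_right : ∀ s₁ s₂, R s₁ s₂ → ∀ σ : ℕ → S', σ 0 = s₂ →
    (∀ i, T₂.TauStep (σ i) (σ (i + 1))) → (∀ i, R s₁ (σ i)) →
    ∃ s₁', T₁.TauStepsPlus s₁ s₁' ∧ ∃ i, R s₁' (σ i)

/-- Divergence-preserving branching bisimilarity. -/
def DPBranchingBisimilar (T₁ : TransitionSystem A S) (T₂ : TransitionSystem A S') : Prop :=
  ∃ R : S → S' → Prop,
    IsDivergencePreservingBranchingBisimulation T₁ T₂ R ∧ R T₁.init T₂.init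

end TransitionSystem

/-- A reactive Turing machine with action symbols `A` and data symbols `D`. A tuple
`(s, d, a, e, M, t)` in `trans` is the transition that, in state `s` with `d` under the head,
executes `a`, writes `e`, moves the head in direction `M`, and ends up in state `t`. -/
structure RTM (A : Type u) (D : Type v) where
  State : Type
  finite_state : Finite State
  trans : Set (State × TapeSymbol D × Act A × TapeSymbol D × Turing.Dir × State)
  init : State
  final : Set State

namespace RTM

variable {A : Type u} {D : Type v}

/-- A configuration: a state and a tape instance, i.e. a two-way infinite tape with all but finitely
many cells blank, and a marked head position. -/
abbrev Config (M : RTM A D) : Type v := M.State × Turing.Tape (TapeSymbol D)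

/-- The blank tape. -/
def blankTape (D : Type v) : Turing.Tape (TapeSymbol D) :=
  { head := none, left := default, right := default }

/-- The transition system associated with a reactive Turing machine. -/
def lts (M : RTM A D) : TransitionSystem A M.Config where
  step c a c' := ∃ (e : TapeSymbol D) (m : Turing.Dir),
    (c.1, c.2.head, a, e, m, c'.1) ∈ M.trans ∧ c'.2 = (c.2.write e).move m
  init := (M.init, blankTape D)
  final := {c | c.1 ∈ M.final}

end RTM

end ReactiveTM

/-!
The machine keeps the code of the current state `s` on its tape. A deterministic silent computation
produces, from the code of `s` and the index of one of its transitions, the code of the target `t`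
together with a number, the menu of `t`, that records whether `t` is final and which labels its
transitions carry. Since branching is bounded, the menus are bounded, so that the menu can be moved
into the finite control, where it decides which transitions the machine offers next. The silent
computations terminate, hence add no divergence, and up to them a configuration does exactly what
the state it represents does. Stack machines evaluating codes of partial recursive functions do the
computing; their tape alphabet is fixed, so the data symbols do not even depend on the labels.
-/

namespace ReactiveTM

open Relation StateTransition Turing

section BisimulationUpToEval

variable {A : Type u} {S : Type v} {C : Type w}

/-- The partial function `f` is the deterministic internal part of `U`: where `f` is defined, the
system `U` is not final and has exactly one transition, a `τ`-step to the value of `f`. -/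
structure IsSilentPart (U : TransitionSystem A C) (f : C → Option C) : Prop where
  step_iff {c c' : C} (h : f c = some c') (a : Act A) (c'' : C) :
    U.step c a c'' ↔ a = tau ∧ c'' = c'
  not_final {c c' : C} (h : f c = some c') : c ∉ U.final

/-- `R` relates a state `s` only to halted configurations that offer the transitions of `s`, where
the target of a transition need only evaluate to a related configuration. -/
structure IsBisimulationUpToEval (T : TransitionSystem A S) (U : TransitionSystem A C)
    (f : C → Option C) (R : S → C → Prop) : Prop where
  halted {s : S} {c : C} (h : R s c) : f c = none
  final_iff {s : S} {c : C} (h : R s c) : c ∈ U.final ↔ s ∈ T.final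
  step_left {s t : S} {c : C} {a : Act A} (h : R s c) (hst : T.step s a t) :
    ∃ c', U.step c a c' ∧ ∃ d ∈ eval f c', R t d
  step_right {s : S} {c c' : C} {a : Act A} (h : R s c) (hc : U.step c a c') :
    ∃ t, T.step s a t ∧ ∃ d ∈ eval f c', R t d

theorem mem_eval_self {f : C → Option C} {c : C} (h : f c = none) : c ∈ eval f c :=
  mem_eval.2 ⟨ReflTransGen.refl, h⟩

theorem eq_of_mem_eval {f : C → Option C} {c d : C} (hd : d ∈ eval f c) (hc : f c = none) :
    c = d :=
  Part.mem_unique (mem_eval_self hc) hd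

theorem eval_eq_of_step {f : C → Option C} {c c' : C} (h : f c = some c') :
    eval f c = eval f c' :=
  reaches_eval (ReflTransGen.single h)

theorem IsSilentPart.tauSteps {U : TransitionSystem A C} {f : C → Option C}
    (hf : IsSilentPart U f) {c d : C} (h : d ∈ eval f c) : U.TauSteps c d :=
  (mem_eval.1 h).1.lift id fun _ b hab => (hf.step_iff hab tau b).2 ⟨rfl, rfl⟩

theorem IsSilentPart.exists_halted {U : TransitionSystem A C} {f : C → Option C}
    (hf : IsSilentPart U f) {d : C} {σ : ℕ → C} (hd : d ∈ eval f (σ 0))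
    (hσ : ∀ i, U.TauStep (σ i) (σ (i + 1))) : ∃ i, f (σ i) = none := by
  suffices ∀ c, d ∈ eval f c → ∀ i, σ i = c → ∃ j, f (σ j) = none from this _ hd 0 rfl
  intro c hc
  refine evalInduction hc fun c _ ih i hi => ?_
  cases hfc : f c with
  | none => exact ⟨i, hi ▸ hfc⟩
  | some b => exact ih b hfc (i + 1) ((hf.step_iff (hi ▸ hfc) tau _).1 (hσ i)).2

namespace IsBisimulationUpToEval

variable {T : TransitionSystem A S} {U : TransitionSystem A C} {f : C → Option C}
  {R : S → C → Prop}

theorem isBranchingBisimulation (hR : IsBisimulationUpToEval T U f R) (hf : IsSilentPart U f) :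
    T.IsBranchingBisimulation U fun s c => ∃ d ∈ eval f c, R s d where
  step_left := by
    rintro s c ⟨d, hd, hsd⟩ a t hst
    obtain ⟨c', hc', htc'⟩ := hR.step_left hsd hst
    exact ⟨d, c', hf.tauSteps hd, Or.inl hc', ⟨d, mem_eval_self (hR.halted hsd), hsd⟩, htc'⟩
  step_right := by
    rintro s c ⟨d, hd, hsd⟩ a c' hcc'
    cases hfc : f c with
    | none =>
      obtain rfl := eq_of_mem_eval hd hfc
      obtain ⟨t, hst, htc'⟩ := hR.step_right hsd hcc'
      exact ⟨s, t, ReflTransGen.refl, Or.inl hst, ⟨c, hd, hsd⟩, htc'⟩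
    | some b =>
      obtain ⟨rfl, rfl⟩ := (hf.step_iff hfc a c').1 hcc'
      exact ⟨s, s, ReflTransGen.refl, Or.inr ⟨rfl, rfl⟩, ⟨d, hd, hsd⟩,
        ⟨d, eval_eq_of_step hfc ▸ hd, hsd⟩⟩
  final_left := by
    rintro s c ⟨d, hd, hsd⟩ hs
    exact ⟨d, hf.tauSteps hd, ⟨d, mem_eval_self (hR.halted hsd), hsd⟩, (hR.final_iff hsd).2 hs⟩
  final_right := by
    rintro s c ⟨d, hd, hsd⟩ hc
    cases hfc : f c with
    | none =>
      obtain rfl := eq_of_mem_eval hd hfc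
      exact ⟨s, ReflTransGen.refl, ⟨c, hd, hsd⟩, (hR.final_iff hsd).1 hc⟩
    | some b => exact absurd hc (hf.not_final hfc)

theorem isDivergencePreservingBranchingBisimulation (hR : IsBisimulationUpToEval T U f R)
    (hf : IsSilentPart U f) :
    T.IsDivergencePreservingBranchingBisimulation U fun s c => ∃ d ∈ eval f c, R s d where
  toIsBranchingBisimulation := hR.isBranchingBisimulation hf
  divergence_left := by
    rintro s c ⟨d, hd, hsd⟩ σ rfl hσ -
    obtain ⟨c', hc', hσc'⟩ := hR.step_left hsd (hσ 0)
    exact ⟨c', TransGen.tail' (hf.tauSteps hd) hc', 1, hσc'⟩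
  divergence_right := by
    rintro s c ⟨d, hd, -⟩ σ rfl hσ hsσ
    obtain ⟨i, hi⟩ := hf.exists_halted hd hσ
    obtain ⟨e, he, hse⟩ := hsσ i
    obtain rfl := eq_of_mem_eval he hi
    obtain ⟨t, hst, htσ⟩ := hR.step_right hse (hσ i)
    exact ⟨t, TransGen.single hst, i + 1, htσ⟩

end IsBisimulationUpToEval

end BisimulationUpToEval

section Epilogue

variable {K Λ σ X : Type*} {Γ : K → Type*}

/-- The statement that extends the internal state by a component `X` and executes `e` where the
given statement would halt. -/
def withEpilogue (e : TM2.Stmt Γ Λ (σ × X)) : TM2.Stmt Γ Λ σ → TM2.Stmt Γ Λ (σ × X)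
  | .push k f q => .push k (fun s => f s.1) (withEpilogue e q)
  | .peek k f q => .peek k (fun s a => (f s.1 a, s.2)) (withEpilogue e q)
  | .pop k f q => .pop k (fun s a => (f s.1 a, s.2)) (withEpilogue e q)
  | .load f q => .load (fun s => (f s.1, s.2)) (withEpilogue e q)
  | .branch p q₁ q₂ => .branch (fun s => p s.1) (withEpilogue e q₁) (withEpilogue e q₂)
  | .goto l => .goto fun s => l s.1
  | .halt => e

theorem supportsStmt_withEpilogue {e : TM2.Stmt Γ Λ (σ × X)} {S : Finset Λ}
    (he : TM2.SupportsStmt S e) {q : TM2.Stmt Γ Λ σ} (hq : TM2.SupportsStmt S q) :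
    TM2.SupportsStmt S (withEpilogue e q) := by
  induction q with
  | push _ _ _ ih => exact ih hq
  | peek _ _ _ ih => exact ih hq
  | pop _ _ _ ih => exact ih hq
  | load _ _ ih => exact ih hq
  | branch _ _ _ ih₁ ih₂ => exact ⟨ih₁ hq.1, ih₂ hq.2⟩
  | goto _ => exact fun v => hq v.1
  | halt => exact he

variable [DecidableEq K]

/-- The configuration of the machine with epilogue `e` that corresponds to a configuration of the
original machine: a halted one corresponds to the result of executing `e`. -/
def epilogueCfg (e : TM2.Stmt Γ Λ (σ × X)) (x : X) : TM2.Cfg Γ Λ σ → TM2.Cfg Γ Λ (σ × X)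
  | ⟨some l, v, S⟩ => ⟨some l, (v, x), S⟩
  | ⟨none, v, S⟩ => TM2.stepAux e (v, x) S

theorem stepAux_withEpilogue (e : TM2.Stmt Γ Λ (σ × X)) (x : X) (q : TM2.Stmt Γ Λ σ) (v : σ)
    (S : ∀ k, List (Γ k)) :
    TM2.stepAux (withEpilogue e q) (v, x) S = epilogueCfg e x (TM2.stepAux q v S) := by
  induction q generalizing v S with
  | push _ _ _ ih => exact ih _ _
  | peek _ _ _ ih => exact ih _ _
  | pop _ _ _ ih => exact ih _ _
  | load _ _ ih => exact ih _ _
  | branch p _ _ ih₁ ih₂ =>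
    simp only [withEpilogue, TM2.stepAux]
    cases p v <;> simp only [cond_true, cond_false, ih₁, ih₂]
  | goto _ => rfl
  | halt => rfl

theorem withEpilogue_respects {e : TM2.Stmt Γ Λ (σ × X)}
    (he : ∀ v S, (TM2.stepAux e v S).l = none) (x : X) (M : Λ → TM2.Stmt Γ Λ σ) :
    Respects (TM2.step M) (TM2.step fun l => withEpilogue e (M l))
      fun a b => epilogueCfg e x a = b := by
  refine fun_respects.2 ?_
  rintro ⟨_ | l, v, S⟩
  · have halts := he (v, x) S
    simp only [TM2.step, FRespects, epilogueCfg]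
    revert halts
    rcases TM2.stepAux e (v, x) S with ⟨_ | l, v', S'⟩ <;> simp
  · refine TransGen.single ?_
    simp [epilogueCfg, stepAux_withEpilogue]

end Epilogue

section ReadNumber

open PartrecToTM2

variable {X : Type*}

theorem trNat_two_mul {m : ℕ} (hm : m ≠ 0) : trNat (2 * m) = .bit0 :: trNat m := by
  have h : ((2 * m : ℕ) : Num) = (m : Num).bit0 := by
    rw [two_mul, Nat.cast_add, Num.bit0_of_bit0]
  have hm' : (m : Num) ≠ 0 := Nat.cast_ne_zero.2 hm
  rw [trNat, trNat, h]
  cases hnum : (m : Num) with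
  | zero => exact absurd hnum hm'
  | pos p => rfl

theorem trNat_two_mul_add_one (m : ℕ) : trNat (2 * m + 1) = .bit1 :: trNat m := by
  have h : ((2 * m + 1 : ℕ) : Num) = (m : Num).bit1 := by
    rw [two_mul, Nat.cast_add, Nat.cast_add, Nat.cast_one, Num.bit1_of_bit1]
  rw [trNat, trNat, h]
  cases (m : Num) <;> rfl

/-- Pops a number `n` of at most `k` binary digits from the main stack, least significant digit
first, and stores `g n` in the internal state; the recursion passes to the number formed by the
remaining digits. -/
def readNumber : ℕ → (ℕ → X) → TM2.Stmt (fun _ : K' => PartrecToTM2.Γ') PartrecToTM2.Λ'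
    (Option PartrecToTM2.Γ' × X)
  | 0, g => .pop K'.main (fun _ _ => (none, g 0)) .halt
  | k + 1, g =>
    .pop K'.main (fun s a => (a, s.2)) <|
      .branch (fun s => s.1 = some .bit0) (readNumber k fun n => g (2 * n)) <|
        .branch (fun s => s.1 = some .bit1) (readNumber k fun n => g (2 * n + 1)) <|
          .load (fun _ => (none, g 0)) .halt

theorem stepAux_readNumber {k n : ℕ} (hn : n < 2 ^ k) (g : ℕ → X) (w : List ℕ) (s) :
    TM2.stepAux (readNumber k g) s (K'.elim (trList (n :: w)) [] [] []) =
      ⟨none, (none, g n), K'.elim (trList w) [] [] []⟩ := by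
  induction k generalizing n g s with
  | zero =>
    obtain rfl : n = 0 := by omega
    simp [readNumber]
  | succ k ih =>
    simp only [trList] at ih ⊢
    rcases Nat.even_or_odd' n with ⟨m, rfl | rfl⟩
    · rcases eq_or_ne m 0 with rfl | hm
      · simp [readNumber]
      · simp [readNumber, trNat_two_mul hm, ih (show m < 2 ^ k by omega)]
    · simp [readNumber, trNat_two_mul_add_one, ih (show m < 2 ^ k by omega)]

theorem stepAux_readNumber_l (k : ℕ) (g : ℕ → X) (s) (S) :
    (TM2.stepAux (readNumber k g) s S).l = none := by
  induction k generalizing g s S with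
  | zero => rfl
  | succ k ih =>
    simp only [readNumber, TM2.stepAux, Bool.cond_decide]
    split_ifs
    exacts [ih _ _ _, ih _ _ _, rfl]

theorem supportsStmt_readNumber (k : ℕ) (g : ℕ → X) (S) :
    TM2.SupportsStmt S (readNumber k g) := by
  induction k generalizing g with
  | zero => trivial
  | succ k ih => exact ⟨ih _, ih _, trivial⟩

end ReadNumber

/-- A finite Post–Turing machine that can be entered at the points `ι` and left at the points `X`.
The exits identify the outcome of a computation by the control state alone. -/
structure PortMachine (Γ : Type v) (ι : Type w) (X : Type u) where
  Q : Type
  [finite : Finite Q]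
  [inhabited : Inhabited Q]
  machine : TM0.Machine Γ Q
  entry : ι → Q
  exit : X → Q
  exit_injective : Function.Injective exit
  machine_exit (x : X) (a : Γ) : machine (exit x) a = none

attribute [instance] PortMachine.finite PortMachine.inhabited

namespace PortMachine

variable {Γ : Type v} {ι : Type w} {X : Type u} [Inhabited Γ]

/-- Entering the machine at `i` on the tape `T` leads to the exit `x` with the tape `T'`. -/
def Evaluates (P : PortMachine Γ ι X) (i : ι) (T : Tape Γ) (x : X) (T' : Tape Γ) : Prop :=
  ⟨P.exit x, T'⟩ ∈ eval (TM0.step P.machine) ⟨P.entry i, T⟩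

variable {Γ₀ : Type*} [Inhabited Γ₀] {Λ : Type} [Inhabited Λ] {M : TM0.Machine Γ₀ Λ} {S : Set Λ}
  [Finite S] (hS : TM0.Supports M S) (encode : PointedMap Γ₀ Γ) (decode : PointedMap Γ Γ₀)
  (entry : ι → S) (exit : X ↪ S)

open Classical in
/-- The machine `M` restricted to the finite set `S` of states and translated to another tape
alphabet. -/
noncomputable def ofSupports (hexit : ∀ x a, M (exit x) a = none) : PortMachine Γ ι X :=
  haveI : Inhabited S := ⟨⟨default, hS.1⟩⟩
  { Q := S
    machine := M.map encode decode (fun q => if h : q ∈ S then ⟨q, h⟩ else default) Subtype.val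
    entry
    exit
    exit_injective := exit.injective
    machine_exit x a := by simp only [TM0.Machine.map, hexit, Option.map_none] }

theorem ofSupports_evaluates {hexit : ∀ x a, M (exit x) a = none}
    (decode_encode : Function.RightInverse encode decode) {i : ι} {x : X} {T T' : Tape Γ₀}
    (h : ⟨(exit x : Λ), T'⟩ ∈ eval (TM0.step M) ⟨(entry i : Λ), T⟩) :
    (ofSupports hS encode decode entry exit hexit).Evaluates i (T.map encode) x
      (T'.map encode) := by
  classical
  let : Inhabited S := ⟨⟨default, hS.1⟩⟩
  let restrict : PointedMap Λ S :=
    ⟨fun q => if h : q ∈ S then ⟨q, h⟩ else default, dif_pos hS.1⟩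
  have restrict_coe (q : S) : restrict q = q := dif_pos q.2
  have respects := TM0.Machine.map_respects M encode decode restrict Subtype.val hS decode_encode
    fun q hq => congrArg Subtype.val (restrict_coe ⟨q, hq⟩)
  obtain ⟨_, ⟨-, rfl⟩, h'⟩ := tr_eval respects ⟨(entry i).2, rfl⟩ h
  simp only [TM0.Cfg.map, restrict_coe] at h'
  exact h'

end PortMachine

section Stacks

variable {K : Type} {Γ : K → Type}

/-- The tape `T` holds the stacks `F`, with their bottoms at the head. -/
def StacksOnTape (F : ∀ k, List (Γ k)) (T : Tape (TM2to1.Γ' K Γ)) : Prop :=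
  ∃ L : ListBlank (∀ k, Option (Γ k)),
    (∀ k, L.map (proj k) = ListBlank.mk ((F k).map some).reverse) ∧
      T = Tape.mk' ∅ (TM2to1.addBottom L)

/-- The symbol that marks the common bottom of empty stacks. -/
def bottomSymbol : TM2to1.Γ' K Γ := (true, fun _ => none)

theorem stacksOnTape_nil :
    StacksOnTape (fun _ => []) ((default : Tape (TM2to1.Γ' K Γ)).write bottomSymbol) :=
  ⟨default, fun _ => rfl, rfl⟩

variable [DecidableEq K] {Λ σ : Type} [Inhabited Λ] [Inhabited σ] [Fintype σ]
  {M : Λ → TM2.Stmt Γ Λ σ} {S : Finset Λ} (hS : TM2.Supports M S)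
  {ι : Type w} {X : Type u} {Δ : Type v} [Inhabited Δ]
  (encode : PointedMap (TM2to1.Γ' K Γ) Δ) (decode : PointedMap Δ (TM2to1.Γ' K Γ))
  (entry : ι → S) (exit : X ↪ σ)

/-- The stack machine `M` compiled to a one-tape machine that is entered at a label of `M` and left
with the internal state of `M` as outcome. -/
noncomputable def PortMachine.ofStackMachine : PortMachine Δ ι X :=
  ofSupports (TM1to0.tr_supports (TM2to1.tr M) (TM2to1.tr_supports M hS)) encode decode
    (fun i => ⟨(some (TM2to1.tr M (.normal (entry i))), default), by
      classical
      exact Finset.mem_product.2 ⟨Finset.some_mem_insertNone.2 (Finset.mem_biUnion.2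
        ⟨_, Finset.mem_biUnion.2 ⟨_, (entry i).2, Finset.mem_insert_self _ _⟩, TM1.stmts₁_self⟩),
        Finset.mem_univ _⟩⟩)
    ⟨fun x => ⟨(none, exit x),
        Finset.mem_product.2 ⟨Finset.none_mem_insertNone, Finset.mem_univ _⟩⟩,
      fun _ _ h => exit.injective (congrArg (fun q => q.1.2) h)⟩
    fun _ _ => rfl

theorem PortMachine.ofStackMachine_evaluates
    (decode_encode : Function.RightInverse encode decode) {i : ι} {x : X}
    {F F' : ∀ k, List (Γ k)} {T : Tape (TM2to1.Γ' K Γ)} (hT : StacksOnTape F T)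
    (h : ⟨none, exit x, F'⟩ ∈ eval (TM2.step M) ⟨some (entry i), default, F⟩) :
    ∃ T', StacksOnTape F' T' ∧ (ofStackMachine hS encode decode entry exit).Evaluates i
      (T.map encode) x (T'.map encode) := by
  obtain ⟨L, hL, rfl⟩ := hT
  obtain ⟨_, ⟨L', hL'⟩, h₁⟩ := tr_eval (TM2to1.tr_respects M) (TM2to1.TrCfg.mk L hL) h
  obtain ⟨_, rfl, h₀⟩ := tr_eval (TM1to0.tr_respects (TM2to1.tr M)) rfl h₁
  exact ⟨_, ⟨L', hL', rfl⟩, ofSupports_evaluates _ _ _ _ _ decode_encode h₀⟩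

end Stacks

section NonBlank

variable (Γ : Type v) [Inhabited Γ]

/-- The data symbols with which a reactive Turing machine represents the tape alphabet `Γ`. -/
abbrev NonBlank : Type v := {g : Γ // g ≠ default}

variable {Γ}

open Classical in
/-- The representation of `Γ` by the tape symbols over `NonBlank Γ`. -/
noncomputable def encodeSymbol : PointedMap Γ (TapeSymbol (NonBlank Γ)) :=
  ⟨(Equiv.optionSubtypeNe default).symm, Equiv.optionSubtypeNe_symm_self _⟩

/-- The inverse of `encodeSymbol`. -/
def decodeSymbol : PointedMap (TapeSymbol (NonBlank Γ)) Γ :=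
  ⟨fun o => o.elim default Subtype.val, rfl⟩

theorem decodeSymbol_encodeSymbol :
    Function.RightInverse (encodeSymbol (Γ := Γ)) decodeSymbol := by
  classical
  intro a
  rcases eq_or_ne a default with rfl | ha
  · rw [encodeSymbol.map_pt]; rfl
  · exact congrArg (Option.elim · default Subtype.val) (Equiv.optionSubtypeNe_symm_of_ne ha)

theorem map_encodeSymbol_default :
    (default : Tape Γ).map encodeSymbol = RTM.blankTape (NonBlank Γ) := by
  have h : encodeSymbol (default : Γ) = none := encodeSymbol.map_pt
  change Tape.mk _ _ _ = Tape.mk _ _ _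
  congr 1

end NonBlank

section Codes

open PartrecToTM2

/-- The alphabet of the tapes that hold the four stacks of the machine evaluating codes. -/
abbrev StackAlphabet : Type := TM2to1.Γ' K' fun _ => PartrecToTM2.Γ'

instance : Fintype K' := ⟨{.main, .rev, .aux, .stack}, fun k => by cases k <;> decide⟩

/-- The data symbols of the reactive Turing machines that evaluate codes. -/
abbrev StackData : Type := NonBlank StackAlphabet

/-- The tape `T` represents the main stack holding the list `v`, the other stacks being empty. -/
def Represents (v : List ℕ) (T : Tape (TapeSymbol StackData)) : Prop :=
  ∃ U, StacksOnTape (K'.elim (trList v) [] [] []) U ∧ T = U.map encodeSymbol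

theorem represents_nil : Represents []
    ((RTM.blankTape StackData).write (encodeSymbol bottomSymbol)) := by
  refine ⟨_, ?_, by rw [← map_encodeSymbol_default, Tape.map_write]⟩
  convert stacksOnTape_nil with k
  cases k <;> rfl

variable (N : ℕ)

/-- The stack machine evaluating codes, modified to move the first number of the result into the
internal state, where it is correct up to `N`. -/
def codeMachine :
    PartrecToTM2.Λ' → TM2.Stmt (fun _ : K' => PartrecToTM2.Γ') PartrecToTM2.Λ'
      (Option PartrecToTM2.Γ' × Fin (N + 1)) :=
  fun l => withEpilogue (readNumber (N + 1) (Fin.ofNat (N + 1))) (tr l)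

theorem codeMachine_eval {N} {c : ToPartrec.Code} {v w : List ℕ} {n : Fin (N + 1)}
    (h : (n : ℕ) :: w ∈ c.eval v) :
    (⟨none, (none, n), K'.elim (trList w) [] [] []⟩ : TM2.Cfg _ _ _) ∈
      eval (TM2.step (codeMachine N))
        ⟨some (trNormal c Cont'.halt), default, K'.elim (trList v) [] [] []⟩ := by
  have h_tr : PartrecToTM2.halt (n :: w) ∈ eval (TM2.step tr) (PartrecToTM2.init c v) := by
    rw [PartrecToTM2.tr_eval]
    exact (Part.mem_map_iff _).2 ⟨_, h, rfl⟩
  have hn : (n : ℕ) < 2 ^ (N + 1) := n.is_lt.trans Nat.lt_two_pow_self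
  obtain ⟨_, h_read, h_eval⟩ := StateTransition.tr_eval
    (withEpilogue_respects (stepAux_readNumber_l (N + 1) (Fin.ofNat (N + 1))) default tr) rfl h_tr
  rw [PartrecToTM2.halt, epilogueCfg, stepAux_readNumber hn, Fin.ofNat_val_eq_self] at h_read
  exact h_read ▸ h_eval

variable {ι : Type w} [Finite ι] (code : ι → ToPartrec.Code)

open Classical in
/-- The labels that `codeMachine` uses to evaluate the codes `code i`. -/
noncomputable def codeLabels : Finset PartrecToTM2.Λ' :=
  haveI := Fintype.ofFinite ι
  insert default (Finset.univ.biUnion fun i => codeSupp (code i) Cont'.halt)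

theorem codeSupp_subset_codeLabels (i : ι) : codeSupp (code i) Cont'.halt ⊆ codeLabels code :=
  (Finset.subset_biUnion_of_mem (fun i => codeSupp (code i) Cont'.halt)
    (@Finset.mem_univ _ (Fintype.ofFinite ι) i)).trans (Finset.subset_insert _ _)

theorem codeMachine_supports : TM2.Supports (codeMachine N) (codeLabels code) := by
  refine ⟨Finset.mem_insert_self _ _, fun l hl => ?_⟩
  refine supportsStmt_withEpilogue (supportsStmt_readNumber _ _ _) ?_
  rcases Finset.mem_insert.1 hl with rfl | hl
  · trivial
  · obtain ⟨i, -, hi⟩ := Finset.mem_biUnion.1 hl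
    exact codeSupp_supports (codeSupp_subset_codeLabels code i) l hi

/-- The label at which `codeMachine` starts to evaluate `code i`. -/
noncomputable def codeLabel (i : ι) : codeLabels code :=
  ⟨trNormal (code i) Cont'.halt,
    codeSupp_subset_codeLabels code i (codeSupp_self _ _ (trStmts₁_self _))⟩

/-- The machine that evaluates `code i` when entered at `i`, and leaves at the first number of the
result with the remaining list on the tape. -/
noncomputable def codePortMachine :
    PortMachine (TapeSymbol StackData) ι (Fin (N + 1)) :=
  .ofStackMachine (codeMachine_supports N code) encodeSymbol decodeSymbol (codeLabel code)
    (.sectR none _)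

theorem codePortMachine_evaluates {N} {code : ι → ToPartrec.Code} {i : ι} {v w : List ℕ}
    {n : Fin (N + 1)} (h : (n : ℕ) :: w ∈ (code i).eval v)
    {T : Tape (TapeSymbol StackData)} (hT : Represents v T) :
    ∃ T', Represents w T' ∧ (codePortMachine N code).Evaluates i T n T' := by
  obtain ⟨U, hU, rfl⟩ := hT
  obtain ⟨U', hU', h'⟩ := PortMachine.ofStackMachine_evaluates (codeMachine_supports N code)
    encodeSymbol decodeSymbol (codeLabel code) (.sectR none _) decodeSymbol_encodeSymbol hU
    (codeMachine_eval h)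
  exact ⟨_, ⟨U', hU', rfl⟩, h'⟩

end Codes

section Control

variable {A : Type u} {D : Type v} {Q : Type}

/-- The deterministic steps on configurations that the control `δ` prescribes. -/
def silentStep (δ : Q → TapeSymbol D → Option (TapeSymbol D × Dir × Q))
    (c : Q × Tape (TapeSymbol D)) : Option (Q × Tape (TapeSymbol D)) :=
  (δ c.1 c.2.head).map fun p => (p.2.2, (c.2.write p.1).move p.2.1)

variable {δ : Q → TapeSymbol D → Option (TapeSymbol D × Dir × Q)}

theorem silentStep_eq_none {c : Q × Tape (TapeSymbol D)} (h : δ c.1 c.2.head = none) :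
    silentStep δ c = none := by
  rw [silentStep, h, Option.map_none]

variable [Finite Q]

/-- The reactive Turing machine that behaves deterministically and silently as prescribed by `δ`,
and may in addition perform `a`, move right, and pass from state `q` to `q'` if `choice q a q'`. -/
def RTM.ofControl (δ : Q → TapeSymbol D → Option (TapeSymbol D × Dir × Q))
    (choice : Q → Act A → Q → Prop) (init : Q) (final : Set Q) : RTM A D where
  State := Q
  finite_state := inferInstance
  trans := {(q, d, a, p) | (a = tau ∧ δ q d = some p) ∨ ∃ q', choice q a q' ∧ p = (d, .right, q')}
  init
  final

variable {choice : Q → Act A → Q → Prop} {init : Q} {final : Set Q}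

theorem RTM.ofControl_step_iff {c c' : Q × Tape (TapeSymbol D)} {a : Act A} :
    (RTM.ofControl δ choice init final).lts.step c a c' ↔
      (a = tau ∧ silentStep δ c = some c') ∨
        ∃ q', choice c.1 a q' ∧ c' = (q', c.2.move .right) := by
  rcases c with ⟨q, T⟩
  rcases c' with ⟨q', T'⟩
  constructor
  · rintro ⟨e, m, ⟨rfl, h⟩ | ⟨q', h, hp⟩, rfl⟩
    · exact Or.inl ⟨rfl, Option.map_eq_some_iff.2 ⟨_, h, rfl⟩⟩
    · cases hp
      exact Or.inr ⟨_, h, by rw [Tape.write_self]⟩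
  · rintro (⟨rfl, h⟩ | ⟨q', h, hp⟩)
    · obtain ⟨⟨e, m, q'⟩, hδ, hp⟩ := Option.map_eq_some_iff.1 h
      cases hp
      exact ⟨e, m, Or.inl ⟨rfl, hδ⟩, rfl⟩
    · cases hp
      exact ⟨_, _, Or.inr ⟨_, h, rfl⟩, by rw [Tape.write_self]⟩

theorem RTM.isSilentPart_ofControl (hchoice : ∀ q a q' d, choice q a q' → δ q d = none)
    (hfinal : ∀ q ∈ final, ∀ d, δ q d = none) :
    IsSilentPart (RTM.ofControl δ choice init final).lts (silentStep δ) where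
  step_iff {c c'} h a c'' := by
    refine RTM.ofControl_step_iff.trans ⟨?_, ?_⟩
    · rintro (⟨ha, h'⟩ | ⟨q', hq', -⟩)
      · exact ⟨ha, Option.some_inj.1 (h'.symm.trans h)⟩
      · cases (silentStep_eq_none (hchoice _ _ _ _ hq')).symm.trans h
    · rintro ⟨ha, rfl⟩
      exact Or.inl ⟨ha, h⟩
  not_final {c c'} h hc := by
    cases (silentStep_eq_none (hfinal c.1 hc _)).symm.trans h

end Control

/-- The states of a reactive Turing machine simulating a Post–Turing machine with states `Q`: in
`boot` it initializes the tape, and in `run q` it simulates the state `q`. A reactive Turing machine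
moves in every step, so after writing it passes through `back q`, where it returns to the cell. -/
inductive SimState (Q : Type) : Type
  | boot : SimState Q
  | run : Q → SimState Q
  | back : Q → SimState Q

instance {Q : Type} [Finite Q] : Finite (SimState Q) := by
  refine Finite.of_surjective (α := Option (Q ⊕ Q))
    (fun o => o.elim .boot (Sum.elim .run .back)) ?_
  rintro (_ | q | q)
  exacts [⟨none, rfl⟩, ⟨some (.inl q), rfl⟩, ⟨some (.inr q), rfl⟩]

section Simulation

variable {D : Type v} {Q : Type} [Inhabited Q] (M : TM0.Machine (TapeSymbol D) Q)
  (mark : TapeSymbol D) (q₀ : Q)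

/-- The deterministic control that writes `mark` and then simulates `M` from the state `q₀`. -/
def simControl : SimState Q → TapeSymbol D → Option (TapeSymbol D × Dir × SimState Q)
  | .boot, _ => some (mark, .right, .back q₀)
  | .back q, d => some (d, .left, .run q)
  | .run q, d => (M q d).map fun p =>
    match p.2 with
    | .move m => (d, m, .run p.1)
    | .write e => (e, .right, .back p.1)

theorem silentStep_boot (T : Tape (TapeSymbol D)) :
    silentStep (simControl M mark q₀) (.boot, T) = some (.back q₀, (T.write mark).move .right) :=
  rfl

theorem silentStep_back (q : Q) (T : Tape (TapeSymbol D)) :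
    silentStep (simControl M mark q₀) (.back q, T.move .right) = some (.run q, T) := by
  simp [silentStep, simControl]

theorem simControl_respects :
    Respects (TM0.step M) (silentStep (simControl M mark q₀))
      fun a b => (SimState.run a.q, a.Tape) = b := by
  refine fun_respects.2 ?_
  rintro ⟨q, T⟩
  rcases h : M q T.head with _ | ⟨q', m | e⟩
  · simp [TM0.step, h, FRespects, silentStep, simControl]
  · simp only [TM0.step, h, Option.map_some, FRespects]
    exact TransGen.single (by simp [silentStep, simControl, h])
  · simp only [TM0.step, h, Option.map_some, FRespects]
    exact TransGen.tail
      (TransGen.single (b := (.back q', (T.write e).move .right))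
        (by simp [silentStep, simControl, h]))
      (silentStep_back M mark q₀ q' _)

end Simulation

namespace PortMachine

variable {A : Type u} {D : Type v} {ι : Type w} {X : Type*} (P : PortMachine (TapeSymbol D) ι X)
  (mark : TapeSymbol D) (start : ι) (choice : X → Act A → ι → Prop) (final : Set X)

/-- The reactive Turing machine that writes `mark` and enters `P` at `start`; whenever it has
arrived at an exit `x`, it may perform `a` and enter `P` at `i` if `choice x a i`. -/
def toRTM : RTM A D :=
  .ofControl (simControl P.machine mark (P.entry start))
    (fun q a q' => ∃ x i, choice x a i ∧ q = .run (P.exit x) ∧ q' = .back (P.entry i))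
    .boot ((fun x => .run (P.exit x)) '' final)

/-- The deterministic silent steps of `P.toRTM`. -/
def toRTMStep : SimState P.Q × Tape (TapeSymbol D) → Option (SimState P.Q × Tape (TapeSymbol D)) :=
  silentStep (simControl P.machine mark (P.entry start))

variable {P mark start choice final}

theorem isSilentPart_toRTMStep :
    IsSilentPart (P.toRTM mark start choice final).lts (P.toRTMStep mark start) := by
  have exit_halted (x : X) (d : TapeSymbol D) :
      simControl P.machine mark (P.entry start) (.run (P.exit x)) d = none := by
    simp [simControl, P.machine_exit]
  refine RTM.isSilentPart_ofControl ?_ ?_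
  · rintro _ a _ d ⟨x, i, -, rfl, -⟩
    exact exit_halted x d
  · rintro _ ⟨x, -, rfl⟩ d
    exact exit_halted x d

theorem toRTMStep_exit (x : X) (T : Tape (TapeSymbol D)) :
    P.toRTMStep mark start (.run (P.exit x), T) = none := by
  simp [toRTMStep, silentStep, simControl, P.machine_exit]

theorem exit_mem_final_iff {x : X} {T : Tape (TapeSymbol D)} :
    (SimState.run (P.exit x), T) ∈ (P.toRTM mark start choice final).lts.final ↔ x ∈ final := by
  constructor
  · rintro ⟨y, hy, h⟩
    exact P.exit_injective (SimState.run.inj h) ▸ hy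
  · exact fun hx => ⟨x, hx, rfl⟩

theorem toRTM_step_exit_iff {x : X} {T : Tape (TapeSymbol D)} {a : Act A}
    {c : SimState P.Q × Tape (TapeSymbol D)} :
    (P.toRTM mark start choice final).lts.step (SimState.run (P.exit x), T) a c ↔
      ∃ i, choice x a i ∧ c = (.back (P.entry i), T.move .right) := by
  refine RTM.ofControl_step_iff.trans ⟨?_, ?_⟩
  · rintro (⟨-, h⟩ | ⟨_, ⟨y, i, hi, h, rfl⟩, rfl⟩)
    · cases (toRTMStep_exit x T).symm.trans h
    · exact ⟨i, P.exit_injective (SimState.run.inj h) ▸ hi, rfl⟩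
  · rintro ⟨i, hi, rfl⟩
    exact Or.inr ⟨_, ⟨x, i, hi, rfl, rfl⟩, rfl⟩

theorem Evaluates.mem_eval_toRTMStep {i : ι} {x : X} {T T' : Tape (TapeSymbol D)}
    (h : P.Evaluates i T x T') :
    (SimState.run (P.exit x), T') ∈
      eval (P.toRTMStep mark start) (.back (P.entry i), T.move .right) := by
  obtain ⟨_, rfl, h'⟩ := tr_eval (simControl_respects P.machine mark (P.entry start)) rfl h
  rw [toRTMStep, eval_eq_of_step (silentStep_back ..)]
  exact h'

variable {S : Type*}

variable (P) in
/-- In the machine `P`, the states `s` of `T` are represented by the tapes `U` with `Rep s U`, and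
`menu s` is the exit at which these tapes are offered. The entries that `choice` lists on the menu
of `s` lead to the successors of `s`. -/
structure Implements (mark : TapeSymbol D) (start : ι) (choice : X → Act A → ι → Prop)
    (final : Set X) (T : TransitionSystem A S) (menu : S → X)
    (Rep : S → Tape (TapeSymbol D) → Prop) : Prop where
  init : ∃ U, Rep T.init U ∧ P.Evaluates start ((RTM.blankTape D).write mark) (menu T.init) U
  final_iff {s : S} : menu s ∈ final ↔ s ∈ T.final
  step_left {s t : S} {a : Act A} (h : T.step s a t) :
    ∃ i, choice (menu s) a i ∧
      ∀ U, Rep s U → ∃ U', Rep t U' ∧ P.Evaluates i U (menu t) U'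
  step_right {s : S} {a : Act A} {i : ι} (h : choice (menu s) a i) :
    ∃ t, T.step s a t ∧
      ∀ U, Rep s U → ∃ U', Rep t U' ∧ P.Evaluates i U (menu t) U'

namespace Implements

variable {T : TransitionSystem A S} {menu : S → X} {Rep : S → Tape (TapeSymbol D) → Prop}

theorem isBisimulationUpToEval (h : P.Implements mark start choice final T menu Rep) :
    IsBisimulationUpToEval T (P.toRTM mark start choice final).lts (P.toRTMStep mark start)
      fun s c => ∃ U, Rep s U ∧ c = (SimState.run (P.exit (menu s)), U) where
  halted := by
    rintro s _ ⟨U, -, rfl⟩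
    exact toRTMStep_exit _ _
  final_iff := by
    rintro s _ ⟨U, -, rfl⟩
    exact exit_mem_final_iff.trans h.final_iff
  step_left := by
    rintro s t _ a ⟨U, hU, rfl⟩ hst
    obtain ⟨i, hi, heval⟩ := h.step_left hst
    obtain ⟨U', hU', hUU'⟩ := heval U hU
    exact ⟨_, toRTM_step_exit_iff.2 ⟨i, hi, rfl⟩, _, hUU'.mem_eval_toRTMStep, U', hU', rfl⟩
  step_right := by
    rintro s _ c a ⟨U, hU, rfl⟩ hc
    obtain ⟨i, hi, rfl⟩ := toRTM_step_exit_iff.1 hc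
    obtain ⟨t, hst, heval⟩ := h.step_right hi
    obtain ⟨U', hU', hUU'⟩ := heval U hU
    exact ⟨t, hst, _, hUU'.mem_eval_toRTMStep, U', hU', rfl⟩

theorem dpBranchingBisimilar (h : P.Implements mark start choice final T menu Rep) :
    T.DPBranchingBisimilar (P.toRTM mark start choice final).lts := by
  obtain ⟨U, hU, heval⟩ := h.init
  refine ⟨_, h.isBisimulationUpToEval.isDivergencePreservingBranchingBisimulation
    isSilentPart_toRTMStep, _, ?_, U, hU, rfl⟩
  have boot := eval_eq_of_step
    (silentStep_boot P.machine mark (P.entry start) (RTM.blankTape D))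
  exact boot ▸ heval.mem_eval_toRTMStep

end Implements

end PortMachine

section Effective

theorem bitIndices_eq_filter_range (n : ℕ) :
    n.bitIndices = (List.range n).filter fun k => n.testBit k := by
  refine n.bitIndices_sorted.pairwise.eq_of_mem_iff (List.pairwise_lt_range.filter _) fun k => ?_
  simpa using fun h => (Nat.lt_two_pow_self).trans_le (Nat.ge_two_pow_of_testBit h)

theorem primrec_bitIndices : Primrec Nat.bitIndices := by
  have pow : Primrec₂ ((· ^ ·) : ℕ → ℕ → ℕ) := Primrec₂.unpaired'.1 Nat.Primrec.pow
  have testBit : PrimrecRel fun k n : ℕ => n.testBit k = true := by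
    simp only [Nat.testBit_eq_decide_div_mod_eq, decide_eq_true_eq]
    exact Primrec.eq.comp (Primrec.nat_mod.comp (Primrec.nat_div.comp Primrec.snd
      (pow.comp (Primrec.const 2) Primrec.fst)) (Primrec.const 2)) (Primrec.const 1)
  refine (testBit.listFilter.comp Primrec.list_range Primrec.id).of_eq fun n => ?_
  simp [bitIndices_eq_filter_range]

theorem exists_code_of_partrec {f : ℕ →. ℕ} (hf : Partrec f) :
    ∃ c : ToPartrec.Code, ∀ n m, m ∈ f n → c.eval [n] = Part.some [m] := by
  obtain ⟨c, hc⟩ := ToPartrec.Code.exists_code (Nat.Partrec'.part_iff₁.2 hf)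
  refine ⟨c, fun n m h => (hc ⟨[n], rfl⟩).trans ?_⟩
  change (f n).map pure = _
  rw [Part.eq_some_iff.2 h, Part.map_some]
  rfl

theorem exists_code_const (n : ℕ) : ∃ c : ToPartrec.Code, c.eval [] = Part.some [n] := by
  obtain ⟨c, hc⟩ := ToPartrec.Code.exists_code
    (Nat.Partrec'.of_prim (n := 0) (Primrec.const n))
  exact ⟨c, (hc ⟨[], rfl⟩).trans (Part.map_some _ _)⟩

open TransitionSystem

variable {A : Type u} {S : Type v}

/-- A presentation of `T` by codes of labels and states, such that from the code of a state one can
compute whether it is final and the set of the pairs of codes of its outgoing transitions, which has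
at most `B` elements. The coding of states need not be injective. -/
structure EffectivePresentation (T : TransitionSystem A S) (B : ℕ) where
  codeAct : Act A → ℕ
  codeState : S → ℕ
  codeAct_injective : Function.Injective codeAct
  outCodes : S → Finset ℕ
  mem_outCodes {s : S} {p : ℕ} :
    p ∈ outCodes s ↔ ∃ a t, T.step s a t ∧ Nat.pair (codeAct a) (codeState t) = p
  card_outCodes_le (s : S) : (outCodes s).card ≤ B
  outN : ℕ →. ℕ
  finN : ℕ →. ℕ
  outN_partrec : Partrec outN
  finN_partrec : Partrec finN
  outN_codeState (s : S) : outN (codeState s) = Part.some (canonicalIndex (outCodes s))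
  finN_codeState (s : S) : finN (codeState s) = Part.some (T.fin s)

theorem TransitionSystem.IsComputable.exists_effectivePresentation {T : TransitionSystem A S}
    (hT : T.IsComputable) (hB : T.BoundedlyBranching) :
    ∃ B, Nonempty (EffectivePresentation T B) := by
  classical
  obtain ⟨hfin, codeAct, codeState, codeAct_injective, -, outN, finN, outN_partrec, finN_partrec,
    outN_codeState, finN_codeState, -⟩ := hT
  obtain ⟨B, hB⟩ := hB
  refine ⟨B, ⟨{
    codeAct, codeState, codeAct_injective, outN, finN, outN_partrec, finN_partrec, finN_codeState,
    outCodes s := (hfin s).toFinset.image fun p => Nat.pair (codeAct p.1) (codeState p.2)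
    outN_codeState s := by convert outN_codeState s
    mem_outCodes := by simp [TransitionSystem.out]
    card_outCodes_le s := ?_ }⟩⟩
  have h := hB s
  rw [(hfin s).encard_eq_coe_toFinset_card, Nat.cast_le] at h
  exact Finset.card_image_le.trans h

namespace EffectivePresentation

variable {T : TransitionSystem A S} {B : ℕ} (E : EffectivePresentation T B)

/-- The codes of the outgoing transitions of a state, in increasing order. -/
def outList (s : S) : List ℕ := (canonicalIndex (E.outCodes s)).bitIndices

theorem mem_outList {s : S} {p : ℕ} :
    p ∈ E.outList s ↔ ∃ a t, T.step s a t ∧ Nat.pair (E.codeAct a) (E.codeState t) = p := by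
  rw [outList, ← List.mem_toFinset, canonicalIndex, Finset.toFinset_bitIndices_sum_two_pow,
    E.mem_outCodes]

theorem length_outList_le (s : S) : (E.outList s).length ≤ B := by
  rw [outList, ← List.toFinset_card_of_nodup Nat.bitIndices_nodup, canonicalIndex,
    Finset.toFinset_bitIndices_sum_two_pow]
  exact E.card_outCodes_le s

/-- The code of what the finite control has to know about a state: whether it is final, and the
labels of its outgoing transitions in the order of `outList`. -/
noncomputable def menuNumber (s : S) : ℕ :=
  Nat.pair (T.fin s) (Encodable.encode ((E.outList s).map fun p => p.unpair.1))

theorem exists_map_codeAct_eq (s : S) : ∃ l : List (Act A), l.length ≤ B ∧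
    l.map E.codeAct = (E.outList s).map fun p => p.unpair.1 := by
  have labels : (E.outList s).map (fun p => p.unpair.1) ∈ Set.range (List.map E.codeAct) := by
    rw [Set.range_list_map]
    rintro _ hx
    obtain ⟨p, hp, rfl⟩ := List.mem_map.1 hx
    obtain ⟨a, t, -, rfl⟩ := E.mem_outList.1 hp
    exact ⟨a, by rw [Nat.unpair_pair]⟩
  obtain ⟨l, hl⟩ := labels
  refine ⟨l, ?_, hl⟩
  simpa [← List.length_map E.codeAct, hl] using E.length_outList_le s

theorem bddAbove_range_menuNumber [Finite A] : BddAbove (Set.range E.menuNumber) := by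
  have menus : (Set.image2 (fun b l => Nat.pair b (Encodable.encode (List.map E.codeAct l)))
      (Set.Iic 1) {l | l.length ≤ B}).Finite :=
    (Set.finite_Iic 1).image2 _ (List.finite_length_le _ B)
  refine menus.bddAbove.mono ?_
  rintro _ ⟨s, rfl⟩
  obtain ⟨l, hl, hls⟩ := E.exists_map_codeAct_eq s
  have fin_le : T.fin s ≤ 1 := by
    rw [TransitionSystem.fin]
    split_ifs <;> simp
  exact ⟨T.fin s, fin_le, l, hl, congrArg (fun m => Nat.pair (T.fin s) (Encodable.encode m)) hls⟩

/-- The menu `m` offers the label `a` as its `i`-th entry. -/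
def Offers (m : ℕ) (a : Act A) (i : ℕ) : Prop :=
  (Denumerable.ofNat (List ℕ) m.unpair.2)[i]? = some (E.codeAct a)

theorem offers_menuNumber_iff {s : S} {a : Act A} {i : ℕ} :
    E.Offers (E.menuNumber s) a i ↔
      ∃ t, T.step s a t ∧ (E.outList s)[i]? = some (Nat.pair (E.codeAct a) (E.codeState t)) := by
  simp only [Offers, menuNumber, Nat.unpair_pair, Denumerable.ofNat_encode, List.getElem?_map,
    Option.map_eq_some_iff]
  constructor
  · rintro ⟨p, hp, hpa⟩
    obtain ⟨a', t, hst, rfl⟩ := E.mem_outList.1 (List.mem_of_getElem? hp)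
    rw [Nat.unpair_pair] at hpa
    exact E.codeAct_injective hpa ▸ ⟨t, hst, hp⟩
  · rintro ⟨t, -, ht⟩
    exact ⟨_, ht, by rw [Nat.unpair_pair]⟩

theorem exists_offers_of_step {s t : S} {a : Act A} (h : T.step s a t) :
    ∃ i : Fin B, (E.outList s)[(i : ℕ)]? = some (Nat.pair (E.codeAct a) (E.codeState t)) := by
  obtain ⟨i, hi, hp⟩ := List.mem_iff_getElem.1 (E.mem_outList.2 ⟨a, t, h, rfl⟩)
  exact ⟨⟨i, hi.trans_le (E.length_outList_le s)⟩, List.getElem?_eq_some_iff.2 ⟨hi, hp⟩⟩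

theorem fin_menuNumber_iff {s : S} : (E.menuNumber s).unpair.1 = 1 ↔ s ∈ T.final := by
  simp [menuNumber, TransitionSystem.fin]

theorem exists_menuCode : ∃ c : ToPartrec.Code, ∀ s,
    c.eval [E.codeState s] = Part.some [E.menuNumber s] := by
  have labels : Primrec fun e : ℕ => Encodable.encode (e.bitIndices.map fun p => p.unpair.1) :=
    Primrec.encode.comp (Primrec.list_map primrec_bitIndices
      (Primrec.fst.comp (Primrec.unpair.comp Primrec.snd)).to₂)
  have menu : Partrec₂ fun n b => (E.outN n).map fun e =>
      Nat.pair b (Encodable.encode (e.bitIndices.map fun p => p.unpair.1)) :=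
    (E.outN_partrec.comp Computable.fst).map (Primrec₂.natPair.comp
      (Primrec.snd.comp Primrec.fst) (labels.comp Primrec.snd)).to_comp.to₂
  obtain ⟨c, hc⟩ := exists_code_of_partrec (E.finN_partrec.bind menu)
  refine ⟨c, fun s => hc _ _ ?_⟩
  refine Part.mem_bind (E.finN_codeState s ▸ Part.mem_some _) ?_
  refine (Part.mem_map_iff _).2 ⟨_, E.outN_codeState s ▸ Part.mem_some _, rfl⟩

theorem exists_succCode (i : ℕ) : ∃ c : ToPartrec.Code, ∀ s t a,
    (E.outList s)[i]? = some (Nat.pair a (E.codeState t)) →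
      c.eval [E.codeState s] = Part.some [E.codeState t] := by
  have get : Primrec fun e : ℕ => (e.bitIndices[i]?.getD 0).unpair.2 :=
    Primrec.snd.comp (Primrec.unpair.comp (Primrec.option_getD.comp
      (Primrec.list_getElem?.comp primrec_bitIndices (Primrec.const i)) (Primrec.const 0)))
  obtain ⟨c, hc⟩ := exists_code_of_partrec
    (E.outN_partrec.map (get.to_comp.comp Computable.snd).to₂)
  refine ⟨c, fun s t a ht => hc _ _ ?_⟩
  rw [outList] at ht
  rw [E.outN_codeState, Part.map_some, ht, Option.getD_some, Nat.unpair_pair]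
  exact Part.mem_some _

theorem exists_stepCode : ∃ code : Option (Fin B) → ToPartrec.Code,
    E.menuNumber T.init :: [E.codeState T.init] ∈ (code none).eval [] ∧
    ∀ (i : Fin B) s t a, (E.outList s)[(i : ℕ)]? = some (Nat.pair a (E.codeState t)) →
      E.menuNumber t :: [E.codeState t] ∈ (code (some i)).eval [E.codeState s] := by
  obtain ⟨menu, hmenu⟩ := E.exists_menuCode
  obtain ⟨init, hinit⟩ := exists_code_const (E.codeState T.init)
  choose succ hsucc using E.exists_succCode
  refine ⟨fun o => (ToPartrec.Code.cons menu .id).comp (o.elim init fun i => succ i), ?_, ?_⟩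
  · simp [hinit, hmenu]
  · intro i s t a h
    simp [hsucc i s t a h, hmenu]

theorem exists_dpBranchingBisimilar [Finite A] (E : EffectivePresentation T B) :
    ∃ M : RTM A StackData, T.DPBranchingBisimilar M.lts := by
  obtain ⟨N, hN⟩ := E.bddAbove_range_menuNumber
  obtain ⟨code, hinit, hsucc⟩ := E.exists_stepCode
  let menu (s : S) : Fin (N + 1) := ⟨E.menuNumber s, Nat.lt_succ_of_le (hN ⟨s, rfl⟩)⟩
  have implements : (codePortMachine N code).Implements (encodeSymbol bottomSymbol) none
      (fun m a o => ∃ i : Fin B, o = some i ∧ E.Offers m a i) {m | (m : ℕ).unpair.1 = 1} T menu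
      fun s U => Represents [E.codeState s] U :=
    { init := codePortMachine_evaluates hinit represents_nil
      final_iff := E.fin_menuNumber_iff
      step_left := fun {s t a} hst => by
        obtain ⟨i, hi⟩ := E.exists_offers_of_step hst
        exact ⟨some i, ⟨i, rfl, E.offers_menuNumber_iff.2 ⟨t, hst, hi⟩⟩,
          fun U hU => codePortMachine_evaluates (hsucc i s t _ hi) hU⟩
      step_right := by
        rintro s a _ ⟨i, rfl, hi⟩
        obtain ⟨t, hst, ht⟩ := E.offers_menuNumber_iff.1 hi
        exact ⟨t, hst, fun U hU => codePortMachine_evaluates (hsucc i s t _ ht) hU⟩ }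
  exact ⟨_, implements.dpBranchingBisimilar⟩

end EffectivePresentation

end Effective

end ReactiveTM

theorem mainTheorem1_general :
    ∃ (D : Type) (_ : Finite D),
      ∀ (A : Type u) [Finite A] (S : Type v) (T : ReactiveTM.TransitionSystem A S) (B : ℕ),
        ReactiveTM.EffectivePresentation T B →
          ∃ M : ReactiveTM.RTM A D, T.DPBranchingBisimilar M.lts :=
  ⟨ReactiveTM.StackData, inferInstance, fun _ _ _ _ _ E => E.exists_dpBranchingBisimilar⟩

theorem mainTheorem1 (A : Type u) [Finite A] :
    ∃ (D : Type) (_ : Finite D),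
      ∀ (S : Type v) (T : ReactiveTM.TransitionSystem A S),
        T.IsComputable → T.BoundedlyBranching →
          ∃ M : ReactiveTM.RTM A D, T.DPBranchingBisimilar M.lts :=
  let ⟨D, hD, simulate⟩ := mainTheorem1_general
  ⟨D, hD, fun S T hT hB => let ⟨B, ⟨E⟩⟩ := hT.exists_effectivePresentation hB; simulate A S T B E⟩
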